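/- **Setting.** Let $n\ge 1$ and $r,k,d\ge 0$ be integers, $t_0\in\mathbb R$, $T>0$, $C=(1,0,\dots,0)^T\in\mathbb R^n$, $A_0=\begin{pmatrix}0&I_{n-1}\\0&0\end{pmatrix}$, and let $b=(1,b_1,\dots,b_{n-1})^T$ be such that all complex roots of $s^{n-1}+b_1s^{n-2}+\dots+b_{n-1}$ have negative real part. Let $\varphi(y,t)\in\mathbb R^r$, $v(y,q,\bar\lambda,t)\in\mathbb R^n$, $w(y,\bar\lambda,t)\in\mathbb R^d$ and $P(y,\bar\lambda,t)=\mathrm{diag}(\alpha_1,\dots,\alpha_d)(y,\bar\lambda,t)$ be continuous, where $y,t\in\mathbb R$, $q\in\mathbb R^d$, $\bar\lambda\in\mathbb R^k$. For $\lambda=(\bar\lambda,q_0)\in\mathbb R^{k+d}$ and a signal $y(\cdot)$ put $$q(t;q_0,\bar\lambda,[y])=e^{\int_{t_0}^tP(y(\tau),\bar\lambda,\tau)d\tau}q_0+\int_{t_0}^te^{\int_\tau^tP(y(s),\bar\lambda,s)ds}w(y(\tau),\bar\lambda,\tau)\,d\tau,\qquad g(y,\lambda,t)=v\big(y(t),q(t;q_0,\bar\lambda,[y]),\bar\lambda,t\big),$$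 and consider the system $$\dot x=A_0x+b\,\varphi(y,t)^T\theta+g(y,\lambda,t),\qquad y=C^Tx,\qquad x(t_0)=x_0,\tag{1}$$ with unknown $x_0\in\mathbb R^n$, $\theta\in\mathbb R^r$, $\lambda\in\mathbb R^{k+d}$. Let $x_0,\tilde\theta,\tilde\lambda$ be the true values, let $x(\cdot)$ be a corresponding solution on $[t_0,\infty)$, and let $y=C^Tx$ be its measured output. **Unique identifiability.** Let $\mathcal E_0$ be the set of $(\theta',\lambda')$ with $b\,\varphi(y(t),t)^T(\theta'-\tilde\theta)+g(y,\lambda',t)-g(y,\tilde\lambda,t)=0$ for all $t\in[t_0,t_0+T]$. Let $\Lambda$ be the $(n-1)\times(n-1)$ matrix with first column $-(b_1,\dots,b_{n-1})^T$, ones on the superdiagonal and zeros elsewhere, let $G=(-(b_1,\dots,b_{n-1})^T\ \ I_{n-1})$, and let $z(\cdot;\lambda')$ solve $\dot z=\Lambda z+Gg(y,\lambda',t)$, $z(t_0)=0$. Let $\mathcal E$ be the set of $(\theta',\lambda')$ for which there is $p\in\mathbb R^{n-1}$ with $$\varphi(y(t),t)^T(\theta'-\tilde\theta)+g_1(y,\lambda',t)-g_1(y,\tilde\lambda,t)+(1,0,\dots,0)\big(e^{\Lambda(t-t_0)}p+z(t;\lambda')-z(t;\tilde\lambda)\big)=0\quad\text{for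 all }t\in[t_0,t_0+T].$$ Assume that $\mathcal E_0=\mathcal E$ and that this set has at most one element. **Periodicity and excitation.** Assume that $y(\cdot)$, $\varphi(y(\cdot),\cdot)$ and $g(y,\tilde\lambda,\cdot)$ are $T$-periodic on $[t_0,\infty)$, and that for some $\delta>0$ $$\int_{t_0}^{t_0+T}\varphi(y(\tau),\tau)\varphi(y(\tau),\tau)^Td\tau\ \ge\ \delta I_r .$$ **Observer.** Let $l\in\mathbb R^n$ be such that $M(A_0+lC^T)+(A_0+lC^T)^TM=-Q$ and $Mb=C$ for some symmetric positive definite matrices $M,Q$, and let $\Phi(t,t_0)$, $t\ge t_0$, be the fundamental matrix, with $\Phi(t_0,t_0)=I_{n+r}$, of $$\frac{d}{dt}\begin{pmatrix}\xi_1\\\xi_2\end{pmatrix}=\begin{pmatrix}A_0+lC^T&b\,\varphi(y(t),t)^T\\-\varphi(y(t),t)C^T&0\end{pmatrix}\begin{pmatrix}\xi_1\\\xi_2\end{pmatrix}.$$ For $\lambda'\in\mathbb R^{k+d}$ put $$f(\lambda',\tau)=\begin{pmatrix}g(y,\lambda',\tau)-l\,y(\tau)\\y(\tau)\varphi(y(\tau),\tau)\end{pmatrix},\qquad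 R(\lambda')=\big(I_{n+r}-\Phi(t_0+T,t_0)\big)^{-1}\Phi(t_0+T,t_0)\int_{t_0}^{t_0+T}\Phi(\tau,t_0)^{-1}f(\lambda',\tau)\,d\tau,$$ $$\hat y(\lambda',t)=(1\ 0\ \cdots\ 0)\Big(\Phi(t,t_0)R(\lambda')+\Phi(t,t_0)\int_{t_0}^t\Phi(\tau,t_0)^{-1}f(\lambda',\tau)\,d\tau\Big).$$ **Theorem.** The matrices $\Phi(t,t_0)$, $t\ge t_0$, and $I_{n+r}-\Phi(t_0+T,t_0)$ are invertible, and for every $\lambda'\in\mathbb R^{k+d}$ the following statements are equivalent: 1. $\hat y(\lambda',t)=y(t)$ for all $t\in[t_0,t_0+T]$; 2. system (1) with initial state $x_0$ and parameters $(\tilde\theta,\lambda')$ has a solution on $[t_0,t_0+T]$ with output $y(t)$ for all $t\in[t_0,t_0+T]$. Furthermore, if these statements hold, then $\begin{pmatrix}x_0\\\tilde\theta\end{pmatrix}=R(\lambda')$. -/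

import Mathlib

open Set Matrix

noncomputable section

namespace AdaptiveObserver

/-- The data of the system
`x' = A₀ x + b φ(y,t)ᵀ θ + v(y,q,μ,t)`, `q' = diag(α(y,μ,t)) q + w(y,μ,t)`, `y = x₁`,
with state `x` of dimension `n + 1` (so every dimension at least one is covered), `q` of dimension
`d`, and parameters `θ` of dimension `r` and `μ` of dimension `k`.
The vector `b` is `(1, β₁, …, βₙ)` with `s ^ n + β₁ s ^ (n-1) + ⋯ + βₙ` Hurwitz. -/
structure SystemData (n r k d : ℕ) where
  /-- the entries of `b` after its leading `1` -/
  β : Fin n → ℝ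
  /-- the regressor -/
  φ : ℝ → ℝ → Fin r → ℝ
  /-- the nonlinearity in the equation of `x` -/
  v : ℝ → (Fin d → ℝ) → (Fin k → ℝ) → ℝ → Fin (n + 1) → ℝ
  /-- the diagonal of the diagonal matrix in the equation of `q` -/
  α : ℝ → (Fin k → ℝ) → ℝ → Fin d → ℝ
  /-- the inhomogeneity in the equation of `q` -/
  w : ℝ → (Fin k → ℝ) → ℝ → Fin d → ℝ
  continuous_φ : Continuous fun p : ℝ × ℝ => φ p.1 p.2
  continuous_v : Continuous fun p : ℝ × (Fin d → ℝ) × (Fin k → ℝ) × ℝ =>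
    v p.1 p.2.1 p.2.2.1 p.2.2.2
  continuous_α : Continuous fun p : ℝ × (Fin k → ℝ) × ℝ => α p.1 p.2.1 p.2.2
  continuous_w : Continuous fun p : ℝ × (Fin k → ℝ) × ℝ => w p.1 p.2.1 p.2.2
  hurwitz : ∀ s : ℂ, s ^ n + ∑ i : Fin n, (β i : ℂ) * s ^ (n - 1 - (i : ℕ)) = 0 → s.re < 0

/-- The nonlinear parameters `(μ, q₀)`: the parameter `μ` and the initial value of `q`. -/
abbrev NonlinParam (k d : ℕ) : Type := (Fin k → ℝ) × (Fin d → ℝ)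

/-- The `m × m` matrix with ones on the first superdiagonal and zeros elsewhere. -/
def shiftMatrix (m : ℕ) : Matrix (Fin m) (Fin m) ℝ :=
  Matrix.of fun i j => if (j : ℕ) = (i : ℕ) + 1 then 1 else 0

/-- The vector `(1, 0, …, 0)` of length `m` (the empty vector if `m = 0`). -/
def firstVec (m : ℕ) : Fin m → ℝ := fun i => if (i : ℕ) = 0 then 1 else 0

/-- `f` is `T`-periodic on `[t₀, ∞)`. -/
def PeriodicFrom {X : Type*} (t₀ T : ℝ) (f : ℝ → X) : Prop :=
  ∀ t, t₀ ≤ t → f (t + T) = f t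

namespace SystemData

variable {n r k d : ℕ} (S : SystemData n r k d)

/-- The vector `b = (1, β₁, …, βₙ)`. -/
def b : Fin (n + 1) → ℝ := Matrix.vecCons 1 S.β

/-- The solution `q` of its linear diagonal equation along the signal `y`, in closed form. -/
def q (t₀ : ℝ) (y : ℝ → ℝ) (lam : NonlinParam k d) (t : ℝ) : Fin d → ℝ := fun i =>
  Real.exp (∫ τ in t₀..t, S.α (y τ) lam.1 τ i) * lam.2 i +
    ∫ τ in t₀..t, Real.exp (∫ s in τ..t, S.α (y s) lam.1 s i) * S.w (y τ) lam.1 τ i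

/-- The term `g(y, lam, t) = v(y, q(t; q₀, μ, [y]), μ, t)`, for `lam = (μ, q₀)`. It depends on the
signal `y` only through its values on `[t₀, t]`. -/
def g (t₀ : ℝ) (y : ℝ → ℝ) (lam : NonlinParam k d) (t : ℝ) : Fin (n + 1) → ℝ :=
  S.v (y t) (S.q t₀ y lam t) lam.1 t

/-- `x` is a solution on the time interval `I` of
`x' = A₀ x + b φ(y,t)ᵀ θ + g(y,lam,t)`, `y = x₁`, `x(t₀) = x₀`. -/
def IsSolutionOn (I : Set ℝ) (t₀ : ℝ) (x₀ : Fin (n + 1) → ℝ) (θ : Fin r → ℝ)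
    (lam : NonlinParam k d) (x : ℝ → Fin (n + 1) → ℝ) : Prop :=
  x t₀ = x₀ ∧ ∀ t ∈ I, HasDerivWithinAt x
    (shiftMatrix (n + 1) *ᵥ x t + (S.φ (x t 0) t ⬝ᵥ θ) • S.b + S.g t₀ (fun s => x s 0) lam t) I t

/-- The `n × n` matrix `Λ`, with first column `-β` and ones on the superdiagonal. -/
def filterΛ : Matrix (Fin n) (Fin n) ℝ :=
  shiftMatrix n - Matrix.vecMulVec S.β (firstVec n)

/-- The `n × (n+1)` matrix `G = (-β  I)`. -/
def filterG : Matrix (Fin n) (Fin (n + 1)) ℝ :=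
  Matrix.of fun i => Matrix.vecCons (-S.β i) fun j => (1 : Matrix (Fin n) (Fin n) ℝ) i j

/-- `z` is the solution on `[t₀, t₀ + T]` of `z' = Λ z + G g(y(t),lam,t)`, `z(t₀) = 0`. -/
def IsFilterState (t₀ T : ℝ) (y : ℝ → ℝ) (lam : NonlinParam k d) (z : ℝ → Fin n → ℝ) : Prop :=
  z t₀ = 0 ∧ ∀ t ∈ Icc t₀ (t₀ + T), HasDerivWithinAt z
    (S.filterΛ *ᵥ z t + S.filterG *ᵥ S.g t₀ y lam t) (Icc t₀ (t₀ + T)) t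

/-- The set `𝓔₀(θ, lam, T)` of parameters that cannot be told apart from `(θ, lam)` when the whole
state is observed on `[t₀, t₀ + T]`. -/
def stateIndist (t₀ T : ℝ) (y : ℝ → ℝ) (θ : Fin r → ℝ) (lam : NonlinParam k d) :
    Set ((Fin r → ℝ) × NonlinParam k d) :=
  {p | ∀ t ∈ Icc t₀ (t₀ + T),
    (S.φ (y t) t ⬝ᵥ (p.1 - θ)) • S.b + S.g t₀ y p.2 t - S.g t₀ y lam t = 0}

/-- The set `𝓔(θ, lam, T)` of the pairs `(θ', lam')` such that, for some vector `c`,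
`φᵀ(θ' - θ) + g₁(lam') - g₁(lam) + (1,0,…,0) exp(Λ(t - t₀)) c + z₁(lam') - z₁(lam) = 0`
on `[t₀, t₀ + T]`. -/
def outputIndist (t₀ T : ℝ) (y : ℝ → ℝ) (θ : Fin r → ℝ) (lam : NonlinParam k d) :
    Set ((Fin r → ℝ) × NonlinParam k d) :=
  {p | ∃ (c : Fin n → ℝ) (z' z : ℝ → Fin n → ℝ),
    S.IsFilterState t₀ T y p.2 z' ∧ S.IsFilterState t₀ T y lam z ∧
    ∀ t ∈ Icc t₀ (t₀ + T),
      S.φ (y t) t ⬝ᵥ (p.1 - θ) + S.g t₀ y p.2 t 0 - S.g t₀ y lam t 0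
        + firstVec n ⬝ᵥ (NormedSpace.exp ((t - t₀) • S.filterΛ) *ᵥ c)
        + firstVec n ⬝ᵥ z' t - firstVec n ⬝ᵥ z t = 0}

/-- Unique identifiability of `(θ, lam)` from the output `y` on `[t₀, t₀ + T]`. -/
def UniquelyIdentifiable (t₀ T : ℝ) (y : ℝ → ℝ) (θ : Fin r → ℝ) (lam : NonlinParam k d) : Prop :=
  S.stateIndist t₀ T y θ lam = S.outputIndist t₀ T y θ lam ∧
    (S.outputIndist t₀ T y θ lam).Subsingleton

/-- Persistent excitation: `∫ φ φᵀ ≥ δ I` over one period. -/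
def PersistentlyExciting (t₀ T δ : ℝ) (y : ℝ → ℝ) : Prop :=
  ((Matrix.of fun i j : Fin r => ∫ τ in t₀..(t₀ + T), S.φ (y τ) τ i * S.φ (y τ) τ j)
    - δ • (1 : Matrix (Fin r) (Fin r) ℝ)).PosSemidef

/-- The matrix `A₀ + l Cᵀ`, where `C = (1, 0, …, 0)`. -/
def closedLoop (l : Fin (n + 1) → ℝ) : Matrix (Fin (n + 1)) (Fin (n + 1)) ℝ :=
  shiftMatrix (n + 1) + Matrix.vecMulVec l (firstVec (n + 1))

/-- The vector `l` satisfies `P (A₀ + l Cᵀ) + (A₀ + l Cᵀ)ᵀ P = -Q` and `P b = C` for some symmetric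
positive definite `P` and `Q`. -/
def IsObserverGain (l : Fin (n + 1) → ℝ) : Prop :=
  ∃ P Q : Matrix (Fin (n + 1)) (Fin (n + 1)) ℝ, P.PosDef ∧ Q.PosDef ∧
    P * closedLoop l + (closedLoop l)ᵀ * P = -Q ∧ P *ᵥ S.b = firstVec (n + 1)

/-- The matrix of the error dynamics, with blocks `A₀ + l Cᵀ`, `b φᵀ`, `-φ Cᵀ` and `0`. -/
def errorMatrix (l : Fin (n + 1) → ℝ) (y : ℝ → ℝ) (t : ℝ) :
    Matrix (Fin (n + 1) ⊕ Fin r) (Fin (n + 1) ⊕ Fin r) ℝ :=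
  Matrix.fromBlocks (closedLoop l) (Matrix.vecMulVec S.b (S.φ (y t) t))
    (-Matrix.vecMulVec (S.φ (y t) t) (firstVec (n + 1))) 0

/-- `t ↦ Φ t` is the fundamental matrix `Φ(t, t₀)` of the error dynamics on `[t₀, ∞)`, normalized by
`Φ(t₀, t₀) = I`. -/
def IsFundamentalMatrix (t₀ : ℝ) (l : Fin (n + 1) → ℝ) (y : ℝ → ℝ)
    (Φ : ℝ → Matrix (Fin (n + 1) ⊕ Fin r) (Fin (n + 1) ⊕ Fin r) ℝ) : Prop :=
  Φ t₀ = 1 ∧ ∀ t ∈ Ici t₀, ∀ i j,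
    HasDerivWithinAt (fun s => Φ s i j) ((S.errorMatrix l y t * Φ t) i j) (Ici t₀) t

/-- The inhomogeneity `(g(y,lam,t) - l y, y φ(y,t))` of the observer. -/
def forcing (t₀ : ℝ) (l : Fin (n + 1) → ℝ) (y : ℝ → ℝ) (lam : NonlinParam k d) (t : ℝ) :
    Fin (n + 1) ⊕ Fin r → ℝ :=
  Sum.elim (S.g t₀ y lam t - y t • l) (y t • S.φ (y t) t)

/-- `∫ Φ(τ, t₀)⁻¹ (g(y,lam,τ) - l y, y φ(y,τ)) dτ` from `t₀` to `t`. -/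
def forcedIntegral (t₀ : ℝ) (l : Fin (n + 1) → ℝ) (y : ℝ → ℝ)
    (Φ : ℝ → Matrix (Fin (n + 1) ⊕ Fin r) (Fin (n + 1) ⊕ Fin r) ℝ)
    (lam : NonlinParam k d) (t : ℝ) : Fin (n + 1) ⊕ Fin r → ℝ :=
  ∫ τ in t₀..t, (Φ τ)⁻¹ *ᵥ S.forcing t₀ l y lam τ

/-- `R(lam)`, the initial value of the periodic solution of the observer. -/
def R (t₀ T : ℝ) (l : Fin (n + 1) → ℝ) (y : ℝ → ℝ)
    (Φ : ℝ → Matrix (Fin (n + 1) ⊕ Fin r) (Fin (n + 1) ⊕ Fin r) ℝ)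
    (lam : NonlinParam k d) : Fin (n + 1) ⊕ Fin r → ℝ :=
  ((1 - Φ (t₀ + T))⁻¹ * Φ (t₀ + T)) *ᵥ S.forcedIntegral t₀ l y Φ lam (t₀ + T)

/-- The explicit integral expression `ŷ(lam, t)`. -/
def yHat (t₀ T : ℝ) (l : Fin (n + 1) → ℝ) (y : ℝ → ℝ)
    (Φ : ℝ → Matrix (Fin (n + 1) ⊕ Fin r) (Fin (n + 1) ⊕ Fin r) ℝ)
    (lam : NonlinParam k d) (t : ℝ) : ℝ :=
  (Φ t *ᵥ S.R t₀ T l y Φ lam + Φ t *ᵥ S.forcedIntegral t₀ l y Φ lam t) (Sum.inl 0)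

end SystemData

end AdaptiveObserver

end

/-! Along a fixed output `y` the system is linear in the state, and replacing `A₀ x` by `(A₀ + l Cᵀ)
x - l y` turns any pair `(x, θ)` with output `y` into a solution of the linear observer equation
with matrix `errorMatrix` and inhomogeneity `forcing` (`SolvesAlong.hasDerivWithinAt_sumElim`). The
vector `R(λ')` is the only initial value whose observer solution returns to it after time `T`,
because `1 - Φ(t₀ + T)` is invertible: a vector fixed by `Φ(t₀ + T)` would give a solution along
which a Lyapunov function is nonincreasing and returns to its initial value, and excitation then
forces the vector to be zero (`IsFundamentalMatrix.isUnit_one_sub`).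

The true state is itself `T`-periodic, since the state is determined by output, parameters and
inhomogeneity (`SolvesAlong.periodicFrom`). Hence `(x₀, θ) = R(λ)` for the true `λ`
(`SolvesAlong.eq_R`).

Both statements about `λ'` force `λ' = λ`. If `ŷ(λ', ·) = y`, the parameter part of the observer has
derivative zero, so the observer state is a genuine solution with output `y` for some `θ'`
(`exists_solvesAlong_of_yHat_eq`). Two solutions with the same output give an element of
`outputIndist` (`SolvesAlong.mem_outputIndist`), which identifiability makes unique. For `λ' = λ`
both statements hold by the previous paragraph. -/

namespace AdaptiveObserver

/-! ### Linear differential equations: product rules, uniqueness, variation of constants -/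

section LinearODE

theorem hasDerivWithinAt_mulVec {ι κ : Type*} [Fintype ι] [Fintype κ] {A : ℝ → Matrix ι κ ℝ}
    {A' : Matrix ι κ ℝ} {u : ℝ → κ → ℝ} {u' : κ → ℝ} {s : Set ℝ} {t : ℝ}
    (hA : ∀ i j, HasDerivWithinAt (fun r => A r i j) (A' i j) s t)
    (hu : HasDerivWithinAt u u' s t) :
    HasDerivWithinAt (fun r => A r *ᵥ u r) (A' *ᵥ u t + A t *ᵥ u') s t := by
  rw [hasDerivWithinAt_pi] at hu ⊢
  intro i
  have := HasDerivWithinAt.fun_sum (u := Finset.univ) fun j _ => (hA i j).mul (hu j)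
  convert! this using 1
  simp [mulVec, dotProduct, Finset.sum_add_distrib]

theorem hasDerivWithinAt_const_mulVec {ι κ : Type*} [Fintype ι] [Fintype κ] (A : Matrix ι κ ℝ)
    {u : ℝ → κ → ℝ} {u' : κ → ℝ} {s : Set ℝ} {t : ℝ} (hu : HasDerivWithinAt u u' s t) :
    HasDerivWithinAt (fun r => A *ᵥ u r) (A *ᵥ u') s t := by
  simpa using hasDerivWithinAt_mulVec (A := fun _ => A) (A' := 0)
    (fun i j => hasDerivWithinAt_const _ _ _) hu

theorem hasDerivWithinAt_dotProduct {ι : Type*} [Fintype ι] {u v : ℝ → ι → ℝ} {u' v' : ι → ℝ}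
    {s : Set ℝ} {t : ℝ} (hu : HasDerivWithinAt u u' s t) (hv : HasDerivWithinAt v v' s t) :
    HasDerivWithinAt (fun r => u r ⬝ᵥ v r) (u' ⬝ᵥ v t + u t ⬝ᵥ v') s t := by
  rw [hasDerivWithinAt_pi] at hu hv
  have := HasDerivWithinAt.fun_sum (u := Finset.univ) fun j _ => (hu j).mul (hv j)
  convert! this using 1
  simp [dotProduct, Finset.sum_add_distrib]

variable {ι : Type*} [Fintype ι]

theorem exists_lipschitz_mulVec {E : ℝ → Matrix ι ι ℝ} {a b : ℝ}
    (hE : ContinuousOn E (Icc a b)) :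
    ∃ K : NNReal, ∀ t ∈ Icc a b, LipschitzOnWith K (fun v : ι → ℝ => E t *ᵥ v) univ := by
  open scoped Matrix.Norms.Operator in
  obtain ⟨K, hK⟩ := isCompact_Icc.exists_bound_of_continuousOn hE
  refine ⟨K.toNNReal, fun t ht => ?_⟩
  refine LipschitzOnWith.of_dist_le_mul fun v _ w _ => ?_
  rw [dist_eq_norm, dist_eq_norm, ← mulVec_sub]
  exact (linfty_opNorm_mulVec _ _).trans
    (mul_le_mul_of_nonneg_right ((hK t ht).trans (Real.le_coe_toNNReal K)) (norm_nonneg _))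

theorem eqOn_of_linear_ode_left {E : ℝ → Matrix ι ι ℝ} {f u w : ℝ → ι → ℝ} {a b : ℝ}
    (hE : ContinuousOn E (Icc a b))
    (hu : ∀ t ∈ Icc a b, HasDerivWithinAt u (E t *ᵥ u t + f t) (Icc a b) t)
    (hw : ∀ t ∈ Icc a b, HasDerivWithinAt w (E t *ᵥ w t + f t) (Icc a b) t)
    (h : u a = w a) : EqOn u w (Icc a b) := by
  obtain ⟨K, hK⟩ := exists_lipschitz_mulVec hE
  refine ODE_solution_unique_of_mem_Icc_right (v := fun t x => E t *ᵥ x + f t)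
    (s := fun _ => univ) (K := K) (fun t ht => ?_) (fun t ht => (hu t ht).continuousWithinAt)
    (fun t ht => ?_) (fun _ _ => mem_univ _) (fun t ht => (hw t ht).continuousWithinAt)
    (fun t ht => ?_) (fun _ _ => mem_univ _) h
  · refine LipschitzOnWith.of_dist_le_mul fun v hv w hw => ?_
    simpa using (hK t (Ico_subset_Icc_self ht)).dist_le_mul v hv w hw
  · exact (hu t (Ico_subset_Icc_self ht)).mono_of_mem_nhdsWithin (Icc_mem_nhdsGE_of_mem ht)
  · exact (hw t (Ico_subset_Icc_self ht)).mono_of_mem_nhdsWithin (Icc_mem_nhdsGE_of_mem ht)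

/-- Uniqueness backwards in time; this is what makes a fundamental matrix injective at every later
time. -/
theorem eq_zero_of_linear_ode_right {E : ℝ → Matrix ι ι ℝ} {u : ℝ → ι → ℝ} {a b : ℝ}
    (hab : a ≤ b) (hE : ContinuousOn E (Icc a b))
    (hu : ∀ t ∈ Icc a b, HasDerivWithinAt u (E t *ᵥ u t) (Icc a b) t)
    (h : u b = 0) : u a = 0 := by
  obtain ⟨K, hK⟩ := exists_lipschitz_mulVec hE
  refine ODE_solution_unique_of_mem_Icc_left (v := fun t x => E t *ᵥ x) (g := fun _ => 0)
    (s := fun _ => univ) (K := K) (fun t ht => hK t (Ioc_subset_Icc_self ht))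
    (fun t ht => (hu t ht).continuousWithinAt)
    (fun t ht => ?_) (fun _ _ => mem_univ _) continuousOn_const
    (fun t ht => ?_) (fun _ _ => mem_univ _) h (left_mem_Icc.2 hab)
  · exact (hu t (Ioc_subset_Icc_self ht)).mono_of_mem_nhdsWithin (Icc_mem_nhdsLE_of_mem ht)
  · simpa using hasDerivWithinAt_const t (Iic t) (0 : ι → ℝ)

theorem hasDerivWithinAt_primitive_Ici {F : Type*} [NormedAddCommGroup F] [NormedSpace ℝ F]
    [CompleteSpace F] {f : ℝ → F} {a t : ℝ} (hf : ContinuousOn f (Ici a)) (ht : a ≤ t) :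
    HasDerivWithinAt (fun s => ∫ τ in a..s, f τ) (f t) (Ici a) t := by
  -- Extending `f` to the left of `a` by the constant `f a` makes the two-sided fundamental theorem
  -- of calculus applicable.
  have hc : Continuous fun s => f (max a s) :=
    hf.comp_continuous (by fun_prop) fun s => mem_Ici.2 (le_max_left a s)
  have h := (hc.integral_hasStrictDerivAt a t).hasDerivAt.hasDerivWithinAt (s := Ici a)
  simp only [max_eq_right ht] at h
  refine h.congr_of_mem (fun s hs => intervalIntegral.integral_congr fun τ hτ => ?_) ht
  rw [uIcc_of_le hs] at hτ
  simp [max_eq_right hτ.1]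

variable [DecidableEq ι]

theorem continuousOn_matrix_inv {X : ℝ → Matrix ι ι ℝ} {s : Set ℝ} (hX : ContinuousOn X s)
    (hu : ∀ t ∈ s, IsUnit (X t)) : ContinuousOn (fun t => (X t)⁻¹) s := by
  intro t ht
  have hd : (X t).det ≠ 0 := ((isUnit_iff_isUnit_det _).1 (hu t ht)).ne_zero
  simp only [Matrix.inv_def, Ring.inverse_eq_inv']
  refine ContinuousWithinAt.smul (f := fun t => (X t).det⁻¹) (g := fun t => (X t).adjugate)
    (ContinuousWithinAt.inv₀ ?_ hd) ?_
  · exact (Continuous.matrix_det continuous_id).continuousAt.comp_continuousWithinAt (hX t ht)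
  · exact (Continuous.matrix_adjugate continuous_id).continuousAt.comp_continuousWithinAt (hX t ht)

/-- Variation of constants. -/
theorem hasDerivWithinAt_variation_of_constants {E X : ℝ → Matrix ι ι ℝ} {f : ℝ → ι → ℝ} {a : ℝ}
    (hX : ∀ t ∈ Ici a, ∀ i j, HasDerivWithinAt (fun s => X s i j) ((E t * X t) i j) (Ici a) t)
    (hu : ∀ t ∈ Ici a, IsUnit (X t)) (hf : ContinuousOn f (Ici a)) (v : ι → ℝ) :
    ∀ t ∈ Ici a, HasDerivWithinAt (fun t => X t *ᵥ (v + ∫ τ in a..t, (X τ)⁻¹ *ᵥ f τ))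
      (E t *ᵥ (X t *ᵥ (v + ∫ τ in a..t, (X τ)⁻¹ *ᵥ f τ)) + f t) (Ici a) t := by
  intro t ht
  have hXc : ContinuousOn X (Ici a) := continuousOn_pi.2 fun i => continuousOn_pi.2 fun j t ht =>
    (hX t ht i j).continuousWithinAt
  have hI : ContinuousOn (fun τ => (X τ)⁻¹ *ᵥ f τ) (Ici a) := by
    have h2 := (continuousOn_matrix_inv hXc hu).prodMk hf
    exact (Continuous.matrix_mulVec continuous_fst continuous_snd :
      Continuous fun p : Matrix ι ι ℝ × (ι → ℝ) => p.1 *ᵥ p.2).comp_continuousOn h2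
  have h := hasDerivWithinAt_mulVec (hX t ht)
    ((hasDerivWithinAt_primitive_Ici hI ht).const_add v)
  convert h using 1
  rw [mulVec_mulVec, mulVec_mulVec, mul_nonsing_inv _ ((isUnit_iff_isUnit_det _).1 (hu t ht)),
    one_mulVec]

theorem hasDerivAt_exp_smul_entry (A : Matrix ι ι ℝ) (a t : ℝ) (i j : ι) :
    HasDerivAt (fun s => NormedSpace.exp ((s - a) • A) i j)
      ((A * NormedSpace.exp ((t - a) • A)) i j) t := by
  open scoped Matrix.Norms.Operator in
  have h := (hasDerivAt_exp_smul_const' (𝕂 := ℝ) A (t - a)).scomp t ((hasDerivAt_id t).sub_const a)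
  rw [one_smul] at h
  exact hasDerivAt_pi.1 (hasDerivAt_pi.1 h i) j

end LinearODE

/-! ### The shift matrix and observability -/

section ShiftMatrix

theorem firstVec_succ_dotProduct {n : ℕ} (v : Fin (n + 1) → ℝ) : firstVec (n + 1) ⬝ᵥ v = v 0 := by
  simp [dotProduct, firstVec]

theorem shiftMatrix_mulVec_zero {n : ℕ} (v : Fin (n + 1) → ℝ) :
    (shiftMatrix (n + 1) *ᵥ v) 0 = firstVec n ⬝ᵥ fun i => v i.succ := by
  simp [mulVec, dotProduct, Fin.sum_univ_succ, shiftMatrix, firstVec]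

theorem shiftMatrix_mulVec_succ {n : ℕ} (v : Fin (n + 1) → ℝ) (i : Fin n) :
    (shiftMatrix (n + 1) *ᵥ v) i.succ = (shiftMatrix n *ᵥ fun i => v i.succ) i := by
  simp [mulVec, dotProduct, Fin.sum_univ_succ, shiftMatrix]

theorem shiftMatrix_mulVec_castSucc {n : ℕ} (v : Fin (n + 1) → ℝ) (i : Fin n) :
    (shiftMatrix (n + 1) *ᵥ v) i.castSucc = v i.succ := by
  rw [mulVec, dotProduct, Finset.sum_eq_single i.succ]
  · simp [shiftMatrix]
  · intro j _ hj
    have : (j : ℕ) ≠ i + 1 := fun h => hj (Fin.ext (by simpa using h))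
    simp [shiftMatrix, this]
  · simp

theorem eq_zero_of_hasDerivWithinAt_of_eqOn_zero {f : ℝ → ℝ} {c : ℝ} {s : Set ℝ} {t : ℝ}
    (hs : UniqueDiffWithinAt ℝ s t) (h : HasDerivWithinAt f c s t) (ht : t ∈ s)
    (h0 : ∀ r ∈ s, f r = 0) : c = 0 :=
  hs.eq_deriv _ h ((hasDerivWithinAt_const t s (0 : ℝ)).congr h0 (h0 t ht))

/-- The pair consisting of the shift matrix and the first coordinate is observable. -/
theorem eq_zero_of_shiftMatrix_ode {n : ℕ} {s : Set ℝ} (hs : UniqueDiffOn ℝ s)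
    {e : ℝ → Fin (n + 1) → ℝ}
    (he : ∀ t ∈ s, HasDerivWithinAt e (shiftMatrix (n + 1) *ᵥ e t) s t)
    (h0 : ∀ t ∈ s, e t 0 = 0) : ∀ t ∈ s, e t = 0 := by
  suffices h : ∀ i : Fin (n + 1), ∀ t ∈ s, e t i = 0 from fun t ht => funext fun i => h i t ht
  intro i
  induction i using Fin.induction with
  | zero => exact h0
  | succ i ih =>
    intro t ht
    -- Coordinate `i + 1` is the derivative of coordinate `i`, which vanishes identically on `s`.
    rw [← shiftMatrix_mulVec_castSucc (e t) i]
    exact eq_zero_of_hasDerivWithinAt_of_eqOn_zero (hs t ht)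
      (hasDerivWithinAt_pi.1 (he t ht) i.castSucc) ht ih

end ShiftMatrix

namespace SystemData

variable {n r k d : ℕ} (S : SystemData n r k d)

theorem closedLoop_mulVec {n : ℕ} (l v : Fin (n + 1) → ℝ) :
    closedLoop l *ᵥ v = shiftMatrix (n + 1) *ᵥ v + v 0 • l := by
  simp [closedLoop, add_mulVec, vecMulVec_mulVec, firstVec_succ_dotProduct]

theorem b_zero : S.b 0 = 1 := rfl

theorem b_succ (i : Fin n) : S.b i.succ = S.β i := rfl

theorem filterΛ_mulVec (v : Fin n → ℝ) :
    S.filterΛ *ᵥ v = shiftMatrix n *ᵥ v - (firstVec n ⬝ᵥ v) • S.β := by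
  simp [filterΛ, sub_mulVec, vecMulVec_mulVec]

theorem filterG_mulVec (v : Fin (n + 1) → ℝ) :
    S.filterG *ᵥ v = fun i => v i.succ - S.β i * v 0 := by
  ext i
  simp [filterG, mulVec, dotProduct, Fin.sum_univ_succ, Matrix.one_apply]
  ring

theorem errorMatrix_mulVec (l : Fin (n + 1) → ℝ) (y : ℝ → ℝ) (t : ℝ)
    (v : Fin (n + 1) ⊕ Fin r → ℝ) :
    S.errorMatrix l y t *ᵥ v =
      Sum.elim (shiftMatrix (n + 1) *ᵥ (v ∘ Sum.inl) + v (Sum.inl 0) • l +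
        (S.φ (y t) t ⬝ᵥ (v ∘ Sum.inr)) • S.b) (-v (Sum.inl 0) • S.φ (y t) t) := by
  rw [errorMatrix, fromBlocks_mulVec, closedLoop_mulVec]
  simp [vecMulVec_mulVec, neg_mulVec, firstVec_succ_dotProduct]

/-! ### Causality and continuity of the nonlinear term -/

section Continuity

variable {t₀ : ℝ} {y y' : ℝ → ℝ} (lam : NonlinParam k d)

/-- Causality of `g`: this allows the output of a solution to be exchanged for the prescribed
signal, and a signal to be altered before `t₀`. -/
theorem g_congr {t : ℝ} (ht : t₀ ≤ t) (h : EqOn y y' (Icc t₀ t)) :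
    S.g t₀ y lam t = S.g t₀ y' lam t := by
  have hint : ∀ τ ∈ Icc t₀ t, ∀ i, ∫ s in τ..t, S.α (y s) lam.1 s i =
      ∫ s in τ..t, S.α (y' s) lam.1 s i := fun τ hτ i => by
    refine intervalIntegral.integral_congr fun s hs => ?_
    rw [uIcc_of_le hτ.2] at hs
    simp only [h ⟨hτ.1.trans hs.1, hs.2⟩]
  have hq : S.q t₀ y lam t = S.q t₀ y' lam t := by
    ext i
    rw [q, q, hint t₀ ⟨le_rfl, ht⟩]
    congr 1
    refine intervalIntegral.integral_congr fun τ hτ => ?_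
    rw [uIcc_of_le ht] at hτ
    simp only [hint τ hτ, h hτ]
  rw [g, g, hq, h ⟨ht, le_rfl⟩]

theorem continuous_g (hy : Continuous y) : Continuous (S.g t₀ y lam) := by
  have hα : ∀ i, Continuous fun s => S.α (y s) lam.1 s i := fun i =>
    (continuous_apply i).comp (S.continuous_α.comp (by fun_prop : Continuous fun s =>
      (y s, lam.1, s)))
  have hw : ∀ i, Continuous fun s => S.w (y s) lam.1 s i := fun i =>
    (continuous_apply i).comp (S.continuous_w.comp (by fun_prop : Continuous fun s =>
      (y s, lam.1, s)))
  have hprim : ∀ i, Continuous fun t => ∫ s in t₀..t, S.α (y s) lam.1 s i := fun i =>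
    intervalIntegral.continuous_primitive (fun a b => (hα i).intervalIntegrable a b) t₀
  have hq : Continuous (S.q t₀ y lam) := by
    refine continuous_pi fun i => ((Real.continuous_exp.comp (hprim i)).mul_const _).add ?_
    refine intervalIntegral.continuous_parametric_intervalIntegral_of_continuous ?_ continuous_id
    refine (Real.continuous_exp.comp ?_).mul ((hw i).comp continuous_snd)
    have : (fun p : ℝ × ℝ => ∫ s in p.2..p.1, S.α (y s) lam.1 s i) = fun p =>
        (∫ s in t₀..p.1, S.α (y s) lam.1 s i) - ∫ s in t₀..p.2, S.α (y s) lam.1 s i :=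
      funext fun p => (intervalIntegral.integral_interval_sub_left
        ((hα i).intervalIntegrable _ _) ((hα i).intervalIntegrable _ _)).symm
    rw [this]
    exact ((hprim i).comp continuous_fst).sub ((hprim i).comp continuous_snd)
  exact S.continuous_v.comp (by fun_prop : Continuous fun t => (y t, S.q t₀ y lam t, lam.1, t))

theorem continuousOn_g (hy : ContinuousOn y (Ici t₀)) :
    ContinuousOn (S.g t₀ y lam) (Ici t₀) := by
  -- Nothing is known about `y` before `t₀`, so it is frozen there at `y t₀`.
  have hc : Continuous fun s => y (max t₀ s) :=
    hy.comp_continuous (by fun_prop) fun s => mem_Ici.2 (le_max_left t₀ s)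
  refine (S.continuous_g lam hc).continuousOn.congr fun t ht => S.g_congr lam ht fun s hs => ?_
  simp [max_eq_right hs.1]

theorem continuousOn_φ (hy : ContinuousOn y (Ici t₀)) :
    ContinuousOn (fun t => S.φ (y t) t) (Ici t₀) :=
  S.continuous_φ.comp_continuousOn (hy.prodMk continuousOn_id)

theorem continuousOn_forcing (l : Fin (n + 1) → ℝ) (hy : ContinuousOn y (Ici t₀)) :
    ContinuousOn (S.forcing t₀ l y lam) (Ici t₀) := by
  refine continuousOn_pi.2 fun i => ?_
  cases i with
  | inl i => exact (continuousOn_pi.1 (S.continuousOn_g lam hy) i).sub (hy.mul continuousOn_const)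
  | inr i => exact hy.mul (continuousOn_pi.1 (S.continuousOn_φ hy) i)

theorem continuousOn_errorMatrix (l : Fin (n + 1) → ℝ) (hy : ContinuousOn y (Ici t₀)) :
    ContinuousOn (S.errorMatrix l y) (Ici t₀) := by
  have hφ := fun i => continuousOn_pi.1 (S.continuousOn_φ hy) i
  refine continuousOn_pi.2 fun i => continuousOn_pi.2 fun j => ?_
  rcases i with i | i <;> rcases j with j | j
  · exact continuousOn_const
  · exact continuousOn_const.mul (hφ j)
  · exact ((hφ i).mul continuousOn_const).neg
  · exact continuousOn_const

end Continuity

/-! ### Solutions sharing an output: identifiability and periodicity -/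

section Identification

variable {t₀ T : ℝ} {y : ℝ → ℝ}

theorem exists_isFilterState (lam : NonlinParam k d) (hy : ContinuousOn y (Ici t₀)) :
    ∃ z, S.IsFilterState t₀ T y lam z := by
  have hf : ContinuousOn (fun t => S.filterG *ᵥ S.g t₀ y lam t) (Ici t₀) :=
    (Continuous.matrix_mulVec continuous_const continuous_id).comp_continuousOn
      (S.continuousOn_g lam hy)
  have h := hasDerivWithinAt_variation_of_constants (E := fun _ => S.filterΛ)
    (X := fun t => NormedSpace.exp ((t - t₀) • S.filterΛ)) (a := t₀)
    (fun t _ i j => (hasDerivAt_exp_smul_entry S.filterΛ t₀ t i j).hasDerivWithinAt)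
    (fun t _ => Matrix.isUnit_exp _) hf 0
  exact ⟨_, by simp, fun t ht => (h t ht.1).mono Icc_subset_Ici_self⟩

/-- `x` solves the system along the prescribed output `y`, on the time interval `I`. -/
def SolvesAlong (I : Set ℝ) (t₀ : ℝ) (y : ℝ → ℝ) (θ : Fin r → ℝ) (lam : NonlinParam k d)
    (x : ℝ → Fin (n + 1) → ℝ) : Prop :=
  ∀ t ∈ I, x t 0 = y t ∧ HasDerivWithinAt x
    (shiftMatrix (n + 1) *ᵥ x t + (S.φ (y t) t ⬝ᵥ θ) • S.b + S.g t₀ y lam t) I t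

variable {S} {θ θ' : Fin r → ℝ} {lam lam' : NonlinParam k d} {x x' : ℝ → Fin (n + 1) → ℝ}

theorem SolvesAlong.mono {I J : Set ℝ} (hx : S.SolvesAlong I t₀ y θ lam x) (h : J ⊆ I) :
    S.SolvesAlong J t₀ y θ lam x :=
  fun t ht => ⟨(hx t (h ht)).1, (hx t (h ht)).2.mono h⟩

theorem IsSolutionOn.solvesAlong {I : Set ℝ} {x₀ : Fin (n + 1) → ℝ}
    (hx : S.IsSolutionOn I t₀ x₀ θ lam x) (hI : ∀ t ∈ I, Icc t₀ t ⊆ I) (hI' : I ⊆ Ici t₀)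
    (h : ∀ t ∈ I, x t 0 = y t) : S.SolvesAlong I t₀ y θ lam x := fun t ht => by
  refine ⟨h t ht, ?_⟩
  have := hx.2 t ht
  rwa [S.g_congr lam (hI' ht) (y' := y) fun s hs => h s (hI t ht hs), h t ht] at this

theorem SolvesAlong.isSolutionOn {I : Set ℝ} (hx : S.SolvesAlong I t₀ y θ lam x)
    (hI : ∀ t ∈ I, Icc t₀ t ⊆ I) (hI' : I ⊆ Ici t₀) :
    S.IsSolutionOn I t₀ (x t₀) θ lam x := by
  refine ⟨rfl, fun t ht => ?_⟩
  have := (hx t ht).2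
  rwa [← S.g_congr lam (hI' ht) (y := fun s => x s 0) fun s hs => (hx s (hI t ht hs)).1,
    ← (hx t ht).1] at this

theorem SolvesAlong.hasDerivWithinAt_sub {I : Set ℝ} (hx : S.SolvesAlong I t₀ y θ lam x)
    (hx' : S.SolvesAlong I t₀ y θ' lam' x') {t : ℝ} (ht : t ∈ I) :
    HasDerivWithinAt (fun t => x' t - x t) (shiftMatrix (n + 1) *ᵥ (x' t - x t) +
      (S.φ (y t) t ⬝ᵥ (θ' - θ)) • S.b + (S.g t₀ y lam' t - S.g t₀ y lam t)) I t := by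
  refine ((hx' t ht).2.sub (hx t ht).2).congr_deriv ?_
  rw [mulVec_sub, dotProduct_sub, sub_smul]
  abel

/-- The first coordinate of the difference of the two states vanishes, hence so does its derivative.
This gives an algebraic relation that eliminates `φᵀ(θ' - θ)` from the other coordinates `η`,
leaving the filter equation `η' = Λ η + G (g(λ') - g(λ))`. The relation is then the equation
defining `outputIndist`. -/
theorem SolvesAlong.mem_outputIndist (hT : 0 < T) (hy : ContinuousOn y (Ici t₀))
    (hx : S.SolvesAlong (Icc t₀ (t₀ + T)) t₀ y θ lam x)
    (hx' : S.SolvesAlong (Icc t₀ (t₀ + T)) t₀ y θ' lam' x') :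
    (θ', lam') ∈ S.outputIndist t₀ T y θ lam := by
  set I := Icc t₀ (t₀ + T) with hI
  have hIu : UniqueDiffOn ℝ I := uniqueDiffOn_Icc (by linarith)
  obtain ⟨z', hz'0, hz'⟩ := S.exists_isFilterState (T := T) lam' hy
  set η : ℝ → Fin n → ℝ := fun t i => x' t i.succ - x t i.succ
  have hsub := fun t ht => hasDerivWithinAt_pi.1 (hx.hasDerivWithinAt_sub hx' (t := t) ht)
  have hzero : ∀ t ∈ I, firstVec n ⬝ᵥ η t + S.φ (y t) t ⬝ᵥ (θ' - θ) +
      (S.g t₀ y lam' t 0 - S.g t₀ y lam t 0) = 0 := fun t ht => by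
    have := eq_zero_of_hasDerivWithinAt_of_eqOn_zero (hIu t ht) (hsub t ht 0) ht
      fun s hs => by simp [(hx s hs).1, (hx' s hs).1]
    simpa [shiftMatrix_mulVec_zero, b_zero, η] using this
  have hη : ∀ t ∈ I, HasDerivWithinAt η (S.filterΛ *ᵥ η t +
      (S.filterG *ᵥ S.g t₀ y lam' t - S.filterG *ᵥ S.g t₀ y lam t)) I t := fun t ht => by
    refine hasDerivWithinAt_pi.2 fun i => ?_
    refine (hsub t ht i.succ).congr_deriv ?_
    symm
    have h0 := hzero t ht
    rw [filterΛ_mulVec, filterG_mulVec, filterG_mulVec]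
    simp only [Pi.add_apply, Pi.sub_apply, Pi.smul_apply, smul_eq_mul, shiftMatrix_mulVec_succ,
      b_succ]
    change _ = (shiftMatrix n *ᵥ η t) i + _ + _
    -- Since `b` has entries `1, βᵢ`, subtracting `βᵢ` times the relation `hzero` removes `φᵀ(θ' -
    -- θ)`.
    linear_combination (- S.β i) * h0
  have hexp : ∀ t ∈ I, HasDerivWithinAt
      (fun t => NormedSpace.exp ((t - t₀) • S.filterΛ) *ᵥ η t₀)
      (S.filterΛ *ᵥ (NormedSpace.exp ((t - t₀) • S.filterΛ) *ᵥ η t₀)) I t := fun t ht => by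
    have := hasDerivWithinAt_mulVec (s := I)
      (fun i j => (hasDerivAt_exp_smul_entry S.filterΛ t₀ t i j).hasDerivWithinAt)
      (hasDerivWithinAt_const t I (η t₀))
    simpa [mulVec_mulVec] using this
  -- The filter state for `lam` is obtained from `z'` and `η`; the exponential term corrects its
  -- initial value to zero and is the term with `c = η t₀`.
  refine ⟨η t₀, z', fun t => z' t - η t + NormedSpace.exp ((t - t₀) • S.filterΛ) *ᵥ η t₀,
    ⟨hz'0, hz'⟩, ⟨by simp [hz'0], fun t ht => ?_⟩, fun t ht => ?_⟩
  · refine (((hz' t ht).sub (hη t ht)).add (hexp t ht)).congr_deriv ?_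
    rw [mulVec_add, mulVec_sub]
    abel
  · simp only [dotProduct_add, dotProduct_sub]
    have := hzero t ht
    rw [dotProduct_sub] at this
    linarith

theorem UniquelyIdentifiable.eq_of_solvesAlong (hT : 0 < T) (hy : ContinuousOn y (Ici t₀))
    (hident : S.UniquelyIdentifiable t₀ T y θ lam)
    (hx : S.SolvesAlong (Icc t₀ (t₀ + T)) t₀ y θ lam x)
    (hx' : S.SolvesAlong (Icc t₀ (t₀ + T)) t₀ y θ' lam' x') : θ' = θ ∧ lam' = lam :=
  -- The true pair belongs to `outputIndist` as well, by comparing `x` with itself.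
  Prod.mk.inj (hident.2 (hx.mem_outputIndist hT hy hx') (hx.mem_outputIndist hT hy hx))

theorem SolvesAlong.eqOn {I : Set ℝ} (hI : UniqueDiffOn ℝ I)
    (hx : S.SolvesAlong I t₀ y θ lam x) (hx' : S.SolvesAlong I t₀ y θ lam x') : EqOn x' x I := by
  intro t ht
  refine sub_eq_zero.1 (eq_zero_of_shiftMatrix_ode hI (e := fun t => x' t - x t)
    (fun t ht => ?_) (fun t ht => ?_) t ht)
  · simpa using hx.hasDerivWithinAt_sub hx' ht
  · simp [(hx t ht).1, (hx' t ht).1]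

/-- By periodicity of the data, the shifted state `x (t + T)` solves the same equation with the same
output, and observability makes it equal to `x`. -/
theorem SolvesAlong.periodicFrom (hT : 0 ≤ T) (hx : S.SolvesAlong (Ici t₀) t₀ y θ lam x)
    (hyper : PeriodicFrom t₀ T y) (hφper : PeriodicFrom t₀ T fun t => S.φ (y t) t)
    (hgper : PeriodicFrom t₀ T fun t => S.g t₀ y lam t) : PeriodicFrom t₀ T x := by
  have hmaps : MapsTo (fun t => t + T) (Ici t₀) (Ici t₀) := fun t ht =>
    mem_Ici.2 (by have := mem_Ici.1 ht; linarith)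
  refine fun t ht => hx.eqOn (uniqueDiffOn_Ici t₀) (x' := fun t => x (t + T)) (fun t ht => ?_) ht
  refine ⟨(hx _ (hmaps ht)).1.trans (hyper t ht), ?_⟩
  have h := (hx _ (hmaps ht)).2
  have h1 := hφper t ht
  have h2 := hgper t ht
  simp only at h1 h2
  rw [h1, h2] at h
  exact (h.scomp t ((hasDerivAt_id t).add_const T).hasDerivWithinAt hmaps).congr_deriv
    (one_smul _ _)

end Identification

end SystemData

/-! ### Lyapunov function, excitation and invertibility -/

theorem lyapunov_identity {ι : Type*} [Fintype ι] {M Q A : Matrix ι ι ℝ} (hM : Mᵀ = M)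
    (h : M * A + Aᵀ * M = -Q) (a b : ι → ℝ) (u : ℝ) :
    (A *ᵥ a + u • b) ⬝ᵥ (M *ᵥ a) + a ⬝ᵥ (M *ᵥ (A *ᵥ a + u • b)) =
      -(a ⬝ᵥ (Q *ᵥ a)) + 2 * u * ((M *ᵥ b) ⬝ᵥ a) := by
  have h1 : (A *ᵥ a) ⬝ᵥ (M *ᵥ a) = a ⬝ᵥ ((Aᵀ * M) *ᵥ a) := by
    rw [← mulVec_mulVec, dotProduct_mulVec a, vecMul_transpose]
  have h2 : a ⬝ᵥ ((Aᵀ * M) *ᵥ a) + a ⬝ᵥ ((M * A) *ᵥ a) = -(a ⬝ᵥ (Q *ᵥ a)) := by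
    rw [← dotProduct_add, ← add_mulVec, add_comm, h, neg_mulVec, dotProduct_neg]
  have h3 : b ⬝ᵥ (M *ᵥ a) = (M *ᵥ b) ⬝ᵥ a := by
    rw [dotProduct_mulVec, ← mulVec_transpose, hM]
  simp only [add_dotProduct, mulVec_add, dotProduct_add, mulVec_smul, dotProduct_smul,
    smul_dotProduct, smul_eq_mul, h1, h3, dotProduct_comm a (M *ᵥ b), mulVec_mulVec]
  linear_combination h2

namespace SystemData

variable {n r k d : ℕ} {S : SystemData n r k d} {t₀ T δ : ℝ} {y : ℝ → ℝ}
  {θ : Fin r → ℝ} {lam : NonlinParam k d} {x : ℝ → Fin (n + 1) → ℝ} {l : Fin (n + 1) → ℝ}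
  {Φ : ℝ → Matrix (Fin (n + 1) ⊕ Fin r) (Fin (n + 1) ⊕ Fin r) ℝ}

/-- If `φᵀ w` vanishes on a period, the Gram matrix kills `w`, and the excitation bound leaves `-δ
|w|² ≥ 0`. -/
theorem PersistentlyExciting.eq_zero (hT : 0 ≤ T) (hδ : 0 < δ) (hy : ContinuousOn y (Ici t₀))
    (hPE : S.PersistentlyExciting t₀ T δ y) {w : Fin r → ℝ}
    (hw : ∀ t ∈ Icc t₀ (t₀ + T), S.φ (y t) t ⬝ᵥ w = 0) : w = 0 := by
  have hle : t₀ ≤ t₀ + T := by linarith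
  have hφ : ∀ i, ContinuousOn (fun t => S.φ (y t) t i) (uIcc t₀ (t₀ + T)) := fun i => by
    rw [uIcc_of_le hle]
    exact (continuousOn_pi.1 (S.continuousOn_φ hy) i).mono Icc_subset_Ici_self
  have hM : (Matrix.of fun i j : Fin r => ∫ τ in t₀..(t₀ + T),
      S.φ (y τ) τ i * S.φ (y τ) τ j) *ᵥ w = 0 := by
    ext i
    simp only [mulVec, dotProduct, of_apply, ← intervalIntegral.integral_mul_const, Pi.zero_apply]
    rw [← intervalIntegral.integral_finsetSum fun j _ => ContinuousOn.intervalIntegrable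
      (by exact ((hφ i).mul (hφ j)).mul continuousOn_const)]
    rw [intervalIntegral.integral_congr (g := fun _ => 0), intervalIntegral.integral_zero]
    intro t ht
    rw [uIcc_of_le hle] at ht
    simp only [mul_assoc, ← Finset.mul_sum]
    exact mul_eq_zero_of_right _ (hw t ht)
  have h := hPE.dotProduct_mulVec_nonneg w
  rw [sub_mulVec, hM, smul_mulVec, one_mulVec] at h
  simp only [star_trivial, zero_sub, dotProduct_neg, dotProduct_smul, smul_eq_mul] at h
  have h0 : 0 ≤ w ⬝ᵥ w := Finset.sum_nonneg fun i _ => mul_self_nonneg (w i)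
  exact dotProduct_self_eq_zero.1 (by nlinarith)

section Fundamental

theorem IsFundamentalMatrix.hasDerivWithinAt_mulVec (hΦ : S.IsFundamentalMatrix t₀ l y Φ)
    (v : Fin (n + 1) ⊕ Fin r → ℝ) {t : ℝ} (ht : t ∈ Ici t₀) :
    HasDerivWithinAt (fun s => Φ s *ᵥ v) (S.errorMatrix l y t *ᵥ (Φ t *ᵥ v)) (Ici t₀) t := by
  have := AdaptiveObserver.hasDerivWithinAt_mulVec (hΦ.2 t ht)
    (hasDerivWithinAt_const t (Ici t₀) v)
  simpa [mulVec_mulVec] using this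

theorem IsFundamentalMatrix.isUnit (hy : ContinuousOn y (Ici t₀))
    (hΦ : S.IsFundamentalMatrix t₀ l y Φ) : ∀ t ∈ Ici t₀, IsUnit (Φ t) := by
  intro t ht
  rw [← mulVec_injective_iff_isUnit, ← Matrix.coe_mulVecLin, injective_iff_map_eq_zero]
  intro v hv
  have := eq_zero_of_linear_ode_right (u := fun s => Φ s *ᵥ v) ht
    ((S.continuousOn_errorMatrix l hy).mono Icc_subset_Ici_self)
    (fun s hs => (hΦ.hasDerivWithinAt_mulVec v hs.1).mono Icc_subset_Ici_self) hv
  simpa [hΦ.1] using this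

/-- The homogeneous error dynamics has no nonzero solution that returns to its initial value. -/
theorem IsFundamentalMatrix.isUnit_one_sub (hT : 0 < T) (hδ : 0 < δ) (hy : ContinuousOn y (Ici t₀))
    (hPE : S.PersistentlyExciting t₀ T δ y) (hl : S.IsObserverGain l)
    (hΦ : S.IsFundamentalMatrix t₀ l y Φ) : IsUnit (1 - Φ (t₀ + T)) := by
  rw [← mulVec_injective_iff_isUnit, ← Matrix.coe_mulVecLin, injective_iff_map_eq_zero]
  intro v hv
  obtain ⟨M, Q, hM, hQ, hMQ, hMb⟩ := hl
  have hMt : Mᵀ = M := by simpa [conjTranspose_eq_transpose_of_trivial] using hM.isHermitian.eq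
  have hret : Φ (t₀ + T) *ᵥ v = v := by
    simp only [coe_mulVecLin, sub_mulVec, one_mulVec] at hv
    exact (sub_eq_zero.1 hv).symm
  set I := Icc t₀ (t₀ + T) with hI
  have hle : t₀ ≤ t₀ + T := by linarith
  have hIu : UniqueDiffOn ℝ I := uniqueDiffOn_Icc (by linarith)
  set a : ℝ → Fin (n + 1) → ℝ := fun t i => (Φ t *ᵥ v) (Sum.inl i)
  set c : ℝ → Fin r → ℝ := fun t i => (Φ t *ᵥ v) (Sum.inr i)
  have hξ : ∀ t ∈ I, HasDerivWithinAt (fun s => Φ s *ᵥ v)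
      (S.errorMatrix l y t *ᵥ (Φ t *ᵥ v)) I t := fun t ht =>
    (hΦ.hasDerivWithinAt_mulVec v ht.1).mono Icc_subset_Ici_self
  have ha : ∀ t ∈ I, HasDerivWithinAt a
      (closedLoop l *ᵥ a t + (S.φ (y t) t ⬝ᵥ c t) • S.b) I t := fun t ht => by
    refine hasDerivWithinAt_pi.2 fun i => ?_
    have := hasDerivWithinAt_pi.1 (hξ t ht) (Sum.inl i)
    rw [errorMatrix_mulVec, Sum.elim_inl] at this
    rw [closedLoop_mulVec]
    exact this
  have hc : ∀ t ∈ I, HasDerivWithinAt c (-a t 0 • S.φ (y t) t) I t := fun t ht => by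
    refine hasDerivWithinAt_pi.2 fun i => ?_
    have := hasDerivWithinAt_pi.1 (hξ t ht) (Sum.inr i)
    rwa [errorMatrix_mulVec, Sum.elim_inr] at this
  -- In `V'` the coupling terms `2 (φᵀc)(Mb)ᵀa` and `-2 a₀ φᵀc` cancel because `M b = C`; only
  -- `-aᵀQa` survives.
  set V : ℝ → ℝ := fun t => a t ⬝ᵥ (M *ᵥ a t) + c t ⬝ᵥ c t
  have hV : ∀ t ∈ I, HasDerivWithinAt V (-(a t ⬝ᵥ (Q *ᵥ a t))) I t := fun t ht => by
    refine ((hasDerivWithinAt_dotProduct (ha t ht)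
      (hasDerivWithinAt_const_mulVec M (ha t ht))).add
      (hasDerivWithinAt_dotProduct (hc t ht) (hc t ht))).congr_deriv ?_
    rw [lyapunov_identity hMt hMQ, hMb, firstVec_succ_dotProduct, smul_dotProduct,
      dotProduct_smul, dotProduct_comm (c t)]
    simp only [smul_eq_mul]
    ring
  have hQ0 : ∀ t, 0 ≤ a t ⬝ᵥ (Q *ᵥ a t) := fun t => by
    simpa using hQ.posSemidef.dotProduct_mulVec_nonneg (a t)
  have hanti : AntitoneOn V I := by
    refine antitoneOn_of_hasDerivWithinAt_nonpos (convex_Icc _ _)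
      (fun t ht => (hV t ht).continuousWithinAt)
      (fun t ht => (hV t (interior_subset ht)).mono interior_subset)
      fun t _ => neg_nonpos.2 (hQ0 t)
  -- `V` is nonincreasing with equal end values, hence constant, and positivity of `Q` then forces
  -- `a = 0`.
  have hVend : V (t₀ + T) = V t₀ := by simp only [V, a, c, hret, hΦ.1, one_mulVec]
  have hVconst : ∀ t ∈ I, V t = V t₀ := fun t ht =>
    le_antisymm (hanti (left_mem_Icc.2 hle) ht ht.1)
      (hVend ▸ hanti ht (right_mem_Icc.2 hle) ht.2)
  have ha0 : ∀ t ∈ I, a t = 0 := fun t ht => by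
    have h := eq_zero_of_hasDerivWithinAt_of_eqOn_zero (hIu t ht) ((hV t ht).sub_const (V t₀)) ht
      fun s hs => sub_eq_zero.2 (hVconst s hs)
    by_contra hne
    have := (posDef_iff_dotProduct_mulVec.1 hQ).2 hne
    simp only [star_trivial] at this
    linarith
  have hcconst : ∀ t ∈ I, c t = c t₀ := by
    refine constant_of_has_deriv_right_zero (fun t ht => (hc t ht).continuousWithinAt) fun t ht => ?_
    have := (hc t (Ico_subset_Icc_self ht)).mono_of_mem_nhdsWithin (Icc_mem_nhdsGE_of_mem ht)
    simpa [ha0 t (Ico_subset_Icc_self ht)] using this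
  -- With `a = 0` and `c` constant, the first coordinate of the equation for `a` reads `φᵀ c = 0`,
  -- as `b` starts with `1`.
  have hc0 : c t₀ = 0 := by
    refine hPE.eq_zero hT.le hδ hy fun t ht => ?_
    have h := eq_zero_of_hasDerivWithinAt_of_eqOn_zero (hIu t ht)
      (hasDerivWithinAt_pi.1 (ha t ht) 0) ht fun s hs => by simp [ha0 s hs]
    simpa [ha0 t ht, hcconst t ht, b_zero] using h
  have hv0 : Φ t₀ *ᵥ v = v := by rw [hΦ.1, one_mulVec]
  rw [← hv0]
  ext i
  rcases i with i | i
  · exact congrFun (ha0 t₀ (left_mem_Icc.2 hle)) i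
  · exact congrFun hc0 i

end Fundamental

/-! ### The observer and its periodic solution -/

section Observer

/-- When the first coordinate is `y`, the terms `± y l` and `± y φ` cancel between matrix and
inhomogeneity. -/
theorem SolvesAlong.hasDerivWithinAt_sumElim {I : Set ℝ} (hx : S.SolvesAlong I t₀ y θ lam x)
    (l : Fin (n + 1) → ℝ) {t : ℝ} (ht : t ∈ I) :
    HasDerivWithinAt (fun t => (Sum.elim (x t) θ : Fin (n + 1) ⊕ Fin r → ℝ))
      (S.errorMatrix l y t *ᵥ Sum.elim (x t) θ + S.forcing t₀ l y lam t) I t := by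
  refine hasDerivWithinAt_pi.2 fun i => ?_
  rw [errorMatrix_mulVec, forcing]
  rcases i with i | i
  · refine (hasDerivWithinAt_pi.1 (hx t ht).2 i).congr_deriv ?_
    simp [(hx t ht).1]
    ring
  · refine (hasDerivWithinAt_const t I (θ i)).congr_deriv ?_
    simp [(hx t ht).1]

/-- The solution of the observer with initial value `R(lam)`. -/
noncomputable def observerState (S : SystemData n r k d) (t₀ T : ℝ) (l : Fin (n + 1) → ℝ) (y : ℝ → ℝ)
    (Φ : ℝ → Matrix (Fin (n + 1) ⊕ Fin r) (Fin (n + 1) ⊕ Fin r) ℝ) (lam : NonlinParam k d)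
    (t : ℝ) : Fin (n + 1) ⊕ Fin r → ℝ :=
  Φ t *ᵥ (S.R t₀ T l y Φ lam + S.forcedIntegral t₀ l y Φ lam t)

theorem yHat_eq (t : ℝ) :
    S.yHat t₀ T l y Φ lam t = S.observerState t₀ T l y Φ lam t (Sum.inl 0) := by
  rw [yHat, observerState, mulVec_add]

theorem IsFundamentalMatrix.hasDerivWithinAt_mulVec_add (hy : ContinuousOn y (Ici t₀))
    (hΦ : S.IsFundamentalMatrix t₀ l y Φ) (v : Fin (n + 1) ⊕ Fin r → ℝ) {t : ℝ}
    (ht : t ∈ Ici t₀) :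
    HasDerivWithinAt (fun t => Φ t *ᵥ (v + S.forcedIntegral t₀ l y Φ lam t))
      (S.errorMatrix l y t *ᵥ (Φ t *ᵥ (v + S.forcedIntegral t₀ l y Φ lam t)) +
        S.forcing t₀ l y lam t) (Ici t₀) t :=
  hasDerivWithinAt_variation_of_constants hΦ.2 (hΦ.isUnit hy) (S.continuousOn_forcing lam l hy) v
    t ht

theorem SolvesAlong.sumElim_eq (hy : ContinuousOn y (Ici t₀))
    (hΦ : S.IsFundamentalMatrix t₀ l y Φ)
    (hx : S.SolvesAlong (Icc t₀ (t₀ + T)) t₀ y θ lam x) :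
    EqOn (fun t => Sum.elim (x t) θ)
      (fun t => Φ t *ᵥ (Sum.elim (x t₀) θ + S.forcedIntegral t₀ l y Φ lam t))
      (Icc t₀ (t₀ + T)) := by
  refine eqOn_of_linear_ode_left
    ((S.continuousOn_errorMatrix l hy).mono Icc_subset_Ici_self)
    (fun t ht => hx.hasDerivWithinAt_sumElim l ht)
    (fun t ht => (hΦ.hasDerivWithinAt_mulVec_add hy _ ht.1).mono Icc_subset_Ici_self) ?_
  simp [hΦ.1, forcedIntegral]

/-- Returning to the initial value turns variation of constants at `t₀ + T` into a linear equation
with matrix `1 - Φ (t₀ + T)`. -/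
theorem SolvesAlong.eq_R (hT : 0 ≤ T) (hy : ContinuousOn y (Ici t₀))
    (hΦ : S.IsFundamentalMatrix t₀ l y Φ) (hunit : IsUnit (1 - Φ (t₀ + T)))
    (hx : S.SolvesAlong (Icc t₀ (t₀ + T)) t₀ y θ lam x) (hret : x (t₀ + T) = x t₀) :
    Sum.elim (x t₀) θ = S.R t₀ T l y Φ lam := by
  have h := hx.sumElim_eq hy hΦ (right_mem_Icc.2 (by linarith))
  simp only [hret, mulVec_add] at h
  have h' : (1 - Φ (t₀ + T)) *ᵥ Sum.elim (x t₀) θ =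
      Φ (t₀ + T) *ᵥ S.forcedIntegral t₀ l y Φ lam (t₀ + T) := by
    rw [sub_mulVec, one_mulVec]
    exact sub_eq_of_eq_add' h
  rw [R, ← mulVec_mulVec, ← h', mulVec_mulVec,
    nonsing_inv_mul _ ((isUnit_iff_isUnit_det _).1 hunit), one_mulVec]

/-- The parameter part of the observer is driven by `(y - ŷ) φ = 0`, so it is a constant `θ'`; the
output injection `(ŷ - y) l` also vanishes. -/
theorem exists_solvesAlong_of_yHat_eq (hy : ContinuousOn y (Ici t₀))
    (hΦ : S.IsFundamentalMatrix t₀ l y Φ)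
    (h : ∀ t ∈ Icc t₀ (t₀ + T), S.yHat t₀ T l y Φ lam t = y t) :
    ∃ θ' x', S.SolvesAlong (Icc t₀ (t₀ + T)) t₀ y θ' lam x' := by
  set I := Icc t₀ (t₀ + T)
  set ζ := S.observerState t₀ T l y Φ lam
  have h0 : ∀ t ∈ I, ζ t (Sum.inl 0) = y t := fun t ht => (yHat_eq t).symm.trans (h t ht)
  have hζ : ∀ t ∈ I, HasDerivWithinAt ζ
      (S.errorMatrix l y t *ᵥ ζ t + S.forcing t₀ l y lam t) I t := fun t ht =>
    (hΦ.hasDerivWithinAt_mulVec_add hy _ ht.1).mono Icc_subset_Ici_self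
  have hθ : ∀ t ∈ I, HasDerivWithinAt (ζ · ∘ Sum.inr) 0 I t := fun t ht => by
    refine hasDerivWithinAt_pi.2 fun i => ?_
    refine (hasDerivWithinAt_pi.1 (hζ t ht) (Sum.inr i)).congr_deriv ?_
    simp [errorMatrix_mulVec, forcing, h0 t ht]
  have hconst : ∀ t ∈ I, ζ t ∘ Sum.inr = ζ t₀ ∘ Sum.inr :=
    constant_of_has_deriv_right_zero (fun t ht => (hθ t ht).continuousWithinAt) fun t ht =>
      (hθ t (Ico_subset_Icc_self ht)).mono_of_mem_nhdsWithin (Icc_mem_nhdsGE_of_mem ht)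
  refine ⟨ζ t₀ ∘ Sum.inr, (ζ · ∘ Sum.inl), fun t ht => ⟨h0 t ht, ?_⟩⟩
  refine hasDerivWithinAt_pi.2 fun i => ?_
  refine (hasDerivWithinAt_pi.1 (hζ t ht) (Sum.inl i)).congr_deriv ?_
  rw [errorMatrix_mulVec, hconst t ht, h0 t ht]
  simp [forcing]
  ring

end Observer

end SystemData
end AdaptiveObserver

/-! ### The main theorem -/

theorem theorem1 {n r k d : ℕ} (S : AdaptiveObserver.SystemData n r k d)
    (t₀ T δ : ℝ) (hT : 0 < T) (hδ : 0 < δ)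
    -- the true initial state and parameters, the solution they generate, and its output
    (x₀ : Fin (n + 1) → ℝ) (θ : Fin r → ℝ) (lam : AdaptiveObserver.NonlinParam k d)
    (x : ℝ → Fin (n + 1) → ℝ) (hx : S.IsSolutionOn (Set.Ici t₀) t₀ x₀ θ lam x)
    (y : ℝ → ℝ) (hy : ∀ t ∈ Set.Ici t₀, y t = x t 0)
    (hident : S.UniquelyIdentifiable t₀ T y θ lam)
    (hyper : AdaptiveObserver.PeriodicFrom t₀ T y)
    (hφper : AdaptiveObserver.PeriodicFrom t₀ T fun t => S.φ (y t) t)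
    (hgper : AdaptiveObserver.PeriodicFrom t₀ T fun t => S.g t₀ y lam t)
    (hPE : S.PersistentlyExciting t₀ T δ y)
    (l : Fin (n + 1) → ℝ) (hl : S.IsObserverGain l)
    (Φ : ℝ → Matrix (Fin (n + 1) ⊕ Fin r) (Fin (n + 1) ⊕ Fin r) ℝ)
    (hΦ : S.IsFundamentalMatrix t₀ l y Φ) :
    (∀ t ∈ Set.Ici t₀, IsUnit (Φ t)) ∧ IsUnit (1 - Φ (t₀ + T)) ∧
    ∀ lam' : AdaptiveObserver.NonlinParam k d,
      ((∀ t ∈ Set.Icc t₀ (t₀ + T), S.yHat t₀ T l y Φ lam' t = y t) ↔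
        (∃ x' : ℝ → Fin (n + 1) → ℝ,
          S.IsSolutionOn (Set.Icc t₀ (t₀ + T)) t₀ x₀ θ lam' x' ∧
          ∀ t ∈ Set.Icc t₀ (t₀ + T), x' t 0 = y t)) ∧
      ((∀ t ∈ Set.Icc t₀ (t₀ + T), S.yHat t₀ T l y Φ lam' t = y t) →
        Sum.elim x₀ θ = S.R t₀ T l y Φ lam') := by
  have hyc : ContinuousOn y (Set.Ici t₀) := fun t ht =>
    (hasDerivWithinAt_pi.1 (hx.2 t ht) 0).continuousWithinAt.congr hy (hy t ht)
  have hΦu := hΦ.isUnit hyc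
  have hunit := hΦ.isUnit_one_sub hT hδ hyc hPE hl
  have hsol : S.SolvesAlong (Set.Ici t₀) t₀ y θ lam x :=
    hx.solvesAlong (fun t _ => Set.Icc_subset_Ici_self) subset_rfl fun t ht => (hy t ht).symm
  have hsolI : S.SolvesAlong (Set.Icc t₀ (t₀ + T)) t₀ y θ lam x :=
    hsol.mono Set.Icc_subset_Ici_self
  have hIcc : ∀ t ∈ Set.Icc t₀ (t₀ + T), Set.Icc t₀ t ⊆ Set.Icc t₀ (t₀ + T) :=
    fun t ht => Set.Icc_subset_Icc_right ht.2
  have hR : Sum.elim x₀ θ = S.R t₀ T l y Φ lam := by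
    rw [← hx.1]
    exact hsolI.eq_R hT.le hyc hΦ hunit
      (hsol.periodicFrom hT.le hyper hφper hgper t₀ le_rfl)
  have hlam : ∀ lam', (∀ t ∈ Set.Icc t₀ (t₀ + T), S.yHat t₀ T l y Φ lam' t = y t) →
      lam' = lam := fun lam' h => by
    obtain ⟨θ', x', hx'⟩ := AdaptiveObserver.SystemData.exists_solvesAlong_of_yHat_eq hyc hΦ h
    exact (hident.eq_of_solvesAlong hT hyc hsolI hx').2
  refine ⟨hΦu, hunit, fun lam' => ⟨⟨fun h => ?_, ?_⟩, fun h => hlam lam' h ▸ hR⟩⟩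
  · obtain rfl := hlam lam' h
    exact ⟨x, hx.1 ▸ hsolI.isSolutionOn hIcc Set.Icc_subset_Ici_self,
      fun t ht => (hy t ht.1).symm⟩
  · rintro ⟨x', hx', hy'⟩ t ht
    -- Identifiability replaces `λ'` by the true parameter, for which the observer started at `R` is
    -- the true pair `(x, θ)`.
    obtain rfl := (hident.eq_of_solvesAlong hT hyc hsolI
      (hx'.solvesAlong hIcc Set.Icc_subset_Ici_self hy')).2
    have h := hsolI.sumElim_eq hyc hΦ ht
    rw [AdaptiveObserver.SystemData.yHat_eq, AdaptiveObserver.SystemData.observerState, ← hR,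
      ← hx.1]
    exact (congrFun h (Sum.inl 0)).symm.trans (hy t ht.1).symm
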